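/- Let $\mathcal H$ and $\mathcal G$ be real Hilbert spaces, let $z\in\mathcal H$ and $r\in\mathcal G$, let $f\colon\mathcal H\to\left]-\infty,+\infty\right]$ and $g\colon\mathcal G\to\left]-\infty,+\infty\right]$ be lower semicontinuous convex functions, and let $L\colon\mathcal H\to\mathcal G$ be a nonzero bounded linear operator with adjoint $L^*$. Write $\operatorname{dom}\varphi=\{x : \varphi(x)<+\infty\}$, and for a convex set $C$ let $\operatorname{sri}C$ be the set of those $x\in C$ for which $\bigcup_{\lambda>0}\lambda(C-x)$ equals the closed linear span of $C-x$. Suppose that $$r\in\operatorname{sri}\big(L(\operatorname{dom}f)-\operatorname{dom}g\big).$$ For a function $\varphi$ on a real Hilbert space with values in $\left]-\infty,+\infty\right]$, let $\varphi^*(u)=\sup_x\big(\langle x,u\rangle-\varphi(x)\big)$ be its conjugate, $\widetilde{\varphi}(x)=\inf_y\big(\varphi(y)+\tfrac12\|x-y\|^2\big)$ its Moreau envelope, $\partial\varphi(x)=\{u : \langle y-x,u\rangle+\varphi(x)\le\varphi(y)\text{ for all }y\}$ its subdifferential, and let $\operatorname{prox}_\varphi x$ be the unique minimizer of $y\mapsto\varphi(y)+\tfrac12\|x-y\|^2$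 when there is one. A solution of a minimization problem is a point at which the objective is less than $+\infty$ and attains its infimum. The Fenchel–Moreau–Rockafellar dual of minimizing $\varphi+\psi\circ M$ over $\mathcal H$ (where $\varphi\colon\mathcal H\to\left]-\infty,+\infty\right]$, $\psi\colon\mathcal G\to\left]-\infty,+\infty\right]$, and $M\colon\mathcal H\to\mathcal G$ is bounded and linear) is the problem of minimizing $v\mapsto\varphi^*(-M^*v)+\psi^*(v)$ over $\mathcal G$. Consider the primal problem $$\underset{x\in\mathcal H}{\mathrm{minimize}}\;\; f(x)+g(Lx-r)+\tfrac12\|x-z\|^2 \tag{P}$$ and the problem $$\underset{v\in\mathcal G}{\mathrm{minimize}}\;\;\widetilde{f^*}(z-L^*v)+g^*(v)+\langle v,r\rangle. \tag{D}$$ 1. (D) is the Fenchel–Moreau–Rockafellar dual of (P). That is, the objective of (P) is $\varphi+\psi\circ L$ with $\varphi=f+\tfrac12\|\cdot-z\|^2$ and $\psi=g(\cdot-r)$; for every $v\in\mathcal G$, $$\varphi^*(-L^*v)+\psi^*(v)=\widetilde{f^*}(z-L^*v)+g^*(v)+\langle v,r\rangle-\tfrac12\|z\|^2;$$ and so minimizing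 $v\mapsto\varphi^*(-L^*v)+\psi^*(v)$ and solving (D) have the same solutions. 2. (D) has at least one solution. 3. $\operatorname{prox}_f x$ is well defined for every $x\in\mathcal H$, and a point $v\in\mathcal G$ is a solution of (D) if and only if $$L\big(\operatorname{prox}_f(z-L^*v)\big)-r\in\partial g^*(v).$$ -/

import Mathlib

open scoped Pointwise

namespace FenchelDuality

noncomputable section

/-- The effective domain `dom φ` of an extended-real-valued function. -/
def dom {E : Type*} (φ : E → EReal) : Set E :=
  {x | φ x < ⊤}

/-- Convexity of a function `φ : E → ]-∞, +∞]` (it is only used for functions that do not take the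
value `⊥`, so that no sum `⊤ + ⊥` occurs). -/
def IsConvex {E : Type*} [AddCommGroup E] [Module ℝ E] (φ : E → EReal) : Prop :=
  ∀ x y : E, ∀ a b : ℝ, 0 < a → 0 < b → a + b = 1 →
    φ (a • x + b • y) ≤ (a : EReal) * φ x + (b : EReal) * φ y

/-- The (proper) minimizers of `φ`: the points of `dom φ` at which `φ` attains its infimum. -/
def Argmin {E : Type*} (φ : E → EReal) : Set E :=
  {x | x ∈ dom φ ∧ ∀ y, φ x ≤ φ y}

/-- The conical hull of `C`: all `c • x` with `c > 0` and `x ∈ C`. -/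
def cone {E : Type*} [AddCommGroup E] [Module ℝ E] (C : Set E) : Set E :=
  {y | ∃ c : ℝ, 0 < c ∧ ∃ x ∈ C, y = c • x}

/-- The strong relative interior of `C`: the points `x ∈ C` such that the conical hull of `C - x`
is the closure of the linear span of `C - x`. -/
def sri {E : Type*} [NormedAddCommGroup E] [NormedSpace ℝ E] (C : Set E) : Set E :=
  {x | x ∈ C ∧ cone (C - {x}) = closure (Submodule.span ℝ (C - {x}) : Set E)}

section Hilbert

variable {E : Type*} [NormedAddCommGroup E] [InnerProductSpace ℝ E]

/-- The Fenchel conjugate `φ*(u) = sup_x (⟪x, u⟫ - φ x)`. -/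
def conj (φ : E → EReal) : E → EReal :=
  fun u => ⨆ x : E, ((inner ℝ x u : ℝ) : EReal) - φ x

/-- The subdifferential `∂φ(x)`. -/
def subdiff (φ : E → EReal) (x : E) : Set E :=
  {u | ∀ y : E, ((inner ℝ (y - x) u : ℝ) : EReal) + φ x ≤ φ y}

/-- The function `y ↦ φ(y) + ½‖x - y‖²`. -/
def proxObjective (φ : E → EReal) (x : E) : E → EReal :=
  fun y => φ y + ((1 / 2 * ‖x - y‖ ^ 2 : ℝ) : EReal)

/-- The Moreau envelope `x ↦ inf_y (φ(y) + ½‖x - y‖²)`. -/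
def moreauEnvelope (φ : E → EReal) : E → EReal :=
  fun x => ⨅ y : E, proxObjective φ x y

open Classical in
/-- The proximity operator: `prox φ x` is the unique minimizer of `y ↦ φ(y) + ½‖x - y‖²`
(and `0` by convention if there is no unique minimizer). -/
def prox (φ : E → EReal) (x : E) : E :=
  if h : ∃! p : E, p ∈ Argmin (proxObjective φ x) then h.choose else 0

end Hilbert

section Problems

variable {H G : Type*} [NormedAddCommGroup H] [InnerProductSpace ℝ H] [CompleteSpace H]
  [NormedAddCommGroup G] [InnerProductSpace ℝ G] [CompleteSpace G]

/-- The objective of the Fenchel-Moreau-Rockafellar dual of minimizing `φ + ψ ∘ M`, that is,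
`v ↦ φ*(-M* v) + ψ*(v)`. -/
def fenchelDualObjective (φ : H → EReal) (ψ : G → EReal) (M : H →L[ℝ] G) : G → EReal :=
  fun v => conj φ (-(ContinuousLinearMap.adjoint M v)) + conj ψ v

/-- The objective of the primal problem, `x ↦ f(x) + g(L x - r) + ½‖x - z‖²`. -/
def primalObjective (f : H → EReal) (g : G → EReal) (L : H →L[ℝ] G) (z : H) (r : G) :
    H → EReal :=
  fun x => f x + g (L x - r) + ((1 / 2 * ‖x - z‖ ^ 2 : ℝ) : EReal)

/-- The objective `v ↦ (f*)~(z - L* v) + g*(v) + ⟪v, r⟫`, where `(f*)~` is the Moreau envelope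
of the conjugate of `f`. -/
def dualObjective (f : H → EReal) (g : G → EReal) (L : H →L[ℝ] G) (z : H) (r : G) :
    G → EReal :=
  fun v => moreauEnvelope (conj f) (z - ContinuousLinearMap.adjoint L v) + conj g v
    + ((inner ℝ v r : ℝ) : EReal)

end Problems

end

end FenchelDuality

/-!
Write `e = (f*)~`. For every `w`, the proximal point `p = prox f w` satisfies `w - p ∈ ∂f(p)`, and
evaluating `e` at this subgradient gives `e(w) = ⟪p, w⟫ - f(p) - ½‖p‖²`
(`moreauEnvelope_conj_eq`). The right-hand side is the supremum of `⟪x, w⟫ - f(x) - ½‖x‖²` over `x`,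
so `e` is the conjugate of `f + ½‖·‖²`; completing the square yields the formula for the dual
objective (`fenchelDualObjective_eq`). The same computation bounds `e` from below by its affine
approximation with slope `p` at `w`, and from above by that approximation plus `½‖· - w‖²`.
Thus `e` is differentiable with gradient `prox f`, and the characterization of the dual solutions is
Fermat's rule (`mem_argmin_dualObjective_iff`).

A dual solution is minus a subgradient at `0` of the value function
`V(y) = inf_x (f(x) + g(L x - r - y) + ½‖x - z‖²)` (`argmin_dualObjective_nonempty`). Two facts
provide the subgradient.

* `V` is lower semicontinuous. As the quadratic term makes the objective strongly convex in `x`,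
  near-minimizers for parameters `yₙ → y` along which `V(yₙ)` tends to the lower limit of `V` at `y`
  form a Cauchy sequence (`exists_proxObjective_le_liminf`), so weak compactness is not needed. For
  a family that is constant in the parameter this is the existence of proximal points.
* The hypothesis on `r` says that the domain of `V` is absorbing in the closed subspace that it
  spans. By Baire's theorem `V` is bounded above on a ball of this subspace, so the
  strict epigraph has nonempty interior there and can be separated from `(0, V(0))` by a hyperplane
  that is not vertical (`exists_continuousLinear_add_le`).

Inequalities between extended real numbers are mostly tested against real bounds, which keeps case
distinctions on infinite values rare.
-/

namespace FenchelDuality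

open Filter Topology Set

/-! ### Affine growth of convex functions -/

section Convexity

variable {X : Type*} [NormedAddCommGroup X] [NormedSpace ℝ X]

/-- Convexity in terms of real upper bounds, which avoids arithmetic in `EReal`. -/
theorem IsConvex.le_coe {E : Type*} [AddCommGroup E] [Module ℝ E] {φ : E → EReal}
    (h : IsConvex φ) {x y : E} {a b α β : ℝ} (ha : 0 < a) (hb : 0 < b) (hab : a + b = 1)
    (hx : φ x ≤ α) (hy : φ y ≤ β) :
    φ (a • x + b • y) ≤ ((a * α + b * β : ℝ) : EReal) := by
  refine (h x y a b ha hb hab).trans ?_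
  rw [EReal.coe_add, EReal.coe_mul, EReal.coe_mul]
  have ha' : (0 : EReal) ≤ a := by exact_mod_cast ha.le
  have hb' : (0 : EReal) ≤ b := by exact_mod_cast hb.le
  exact add_le_add (mul_le_mul_of_nonneg_left hx ha') (mul_le_mul_of_nonneg_left hy hb')

/-- A lower semicontinuous convex function decreases at most linearly. Near a point `x₀` of its
domain it is at least `φ x₀ - 1`; convexity along the segment from `x₀` to a far point propagates
this bound, so that no separation theorem is needed. -/
theorem exists_sub_mul_norm_le {φ : X → EReal} (hbot : ∀ x, φ x ≠ ⊥) (hconv : IsConvex φ)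
    (hlsc : LowerSemicontinuous φ) :
    ∃ A B : ℝ, 0 ≤ B ∧ ∀ x, ((A - B * ‖x‖ : ℝ) : EReal) ≤ φ x := by
  by_cases hne : ∃ x₀, φ x₀ ≠ ⊤
  swap
  · push Not at hne
    exact ⟨0, 0, le_rfl, fun x => by simp [hne x]⟩
  obtain ⟨x₀, hx₀⟩ := hne
  obtain ⟨c, hc⟩ : ∃ c : ℝ, φ x₀ = c := ⟨_, (EReal.coe_toReal hx₀ (hbot x₀)).symm⟩
  have hlt : ((c - 1 : ℝ) : EReal) < φ x₀ := by
    rw [hc]; exact_mod_cast sub_one_lt c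
  obtain ⟨δ, hδ, hball⟩ := Metric.eventually_nhds_iff.1 (hlsc x₀ _ hlt)
  refine ⟨c - 1 - 2 / δ * ‖x₀‖, 2 / δ, by positivity, fun x => ?_⟩
  rw [← EReal.le_of_forall_lt_iff_le]
  intro β hβ
  rw [EReal.coe_le_coe_iff]
  have hd : ‖x - x₀‖ ≤ ‖x‖ + ‖x₀‖ := norm_sub_le _ _
  have hd' : 2 / δ * ‖x - x₀‖ ≤ 2 / δ * (‖x‖ + ‖x₀‖) := by gcongr
  suffices c - 1 - 2 / δ * ‖x - x₀‖ ≤ β by linarith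
  have h0 : 0 ≤ 2 / δ * ‖x - x₀‖ := by positivity
  rcases lt_or_ge ‖x - x₀‖ δ with hnear | hfar
  · have := (hball (by rwa [dist_eq_norm] : dist x x₀ < δ)).trans hβ
    have : c - 1 < β := by exact_mod_cast this
    linarith
  · have hpos : 0 < ‖x - x₀‖ := hδ.trans_le hfar
    obtain ⟨t, ht⟩ : ∃ t, t = δ / (2 * ‖x - x₀‖) := ⟨_, rfl⟩
    have ht0 : 0 < t := by rw [ht]; positivity
    have htd : t * ‖x - x₀‖ = δ / 2 := by rw [ht]; field_simp
    have ht1 : t < 1 := by nlinarith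
    have hle := hconv.le_coe (sub_pos.2 ht1) ht0 (by ring) hc.le hβ.le
    have hdist : dist ((1 - t) • x₀ + t • x) x₀ < δ := by
      have : (1 - t) • x₀ + t • x - x₀ = t • (x - x₀) := by module
      rw [dist_eq_norm, this, norm_smul, Real.norm_of_nonneg ht0.le, htd]
      linarith
    have hlt := (hball hdist).trans_le hle
    have hlt : c - 1 < (1 - t) * c + t * β := by exact_mod_cast hlt
    have h2 : t * (2 / δ * ‖x - x₀‖) = 1 := by
      have : t * (2 / δ * ‖x - x₀‖) = 2 / δ * (t * ‖x - x₀‖) := by ring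
      rw [this, htd]; field_simp
    by_contra! hcon
    nlinarith

end Convexity

/-! ### Moreau envelopes depending on a parameter -/

theorem proxObjective_le_coe_iff {H : Type*} [NormedAddCommGroup H] {φ : H → EReal} {z x : H}
    {α : ℝ} :
    proxObjective φ z x ≤ α ↔ φ x ≤ ((α - 1 / 2 * ‖z - x‖ ^ 2 : ℝ) : EReal) := by
  rw [proxObjective]
  induction φ x with
  | bot => simp
  | top => rw [EReal.top_add_coe]; simp only [top_le_iff, EReal.coe_ne_top]
  | coe c => norm_cast; constructor <;> intro h <;> linarith

theorem lowerSemicontinuous_proxObjective {H E : Type*} [NormedAddCommGroup H]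
    [NormedAddCommGroup E] {Ψ : H × E → EReal} (hlsc : LowerSemicontinuous Ψ) (z : H) :
    LowerSemicontinuous fun p : H × E => proxObjective (fun x => Ψ (x, p.2)) z p.1 := by
  unfold proxObjective
  refine LowerSemicontinuous.add' (f := fun p : H × E => Ψ (p.1, p.2)) hlsc
    (Continuous.lowerSemicontinuous ?_) fun p => ?_
  · exact continuous_coe_real_ereal.comp (by fun_prop)
  · exact EReal.continuousAt_add (Or.inr (EReal.coe_ne_bot _)) (Or.inr (EReal.coe_ne_top _))

section ParametricEnvelope

variable {H E : Type*} [NormedAddCommGroup H] [InnerProductSpace ℝ H]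
  [NormedAddCommGroup E] [NormedSpace ℝ E]

theorem norm_sub_convexCombination_sq (z p q : H) {a b : ℝ} (hab : a + b = 1) :
    ‖z - (a • p + b • q)‖ ^ 2 = a * ‖z - p‖ ^ 2 + b * ‖z - q‖ ^ 2 - a * b * ‖p - q‖ ^ 2 := by
  obtain rfl : b = 1 - a := by linarith
  have h1 : z - (a • p + (1 - a) • q) = a • (z - p) + (1 - a) • (z - q) := by module
  have h2 : p - q = (z - q) - (z - p) := by abel
  rw [h1, h2, norm_add_sq_real, norm_sub_sq_real (z - q) (z - p), norm_smul, norm_smul,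
    real_inner_smul_left, real_inner_smul_right, mul_pow, mul_pow,
    real_inner_comm (z - p) (z - q)]
  simp only [Real.norm_eq_abs, sq_abs]
  ring

/-- Strong convexity in the first variable of `(x, y) ↦ Ψ(x, y) + ½‖z - x‖²` for a jointly convex
function `Ψ`. -/
theorem proxObjective_convexCombination_le {Ψ : H × E → EReal} (hconv : IsConvex Ψ) (z : H)
    {x x' : H} {y y' : E} {a b α β : ℝ} (ha : 0 < a) (hb : 0 < b) (hab : a + b = 1)
    (hα : proxObjective (fun x => Ψ (x, y)) z x ≤ α)
    (hβ : proxObjective (fun x => Ψ (x, y')) z x' ≤ β) :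
    proxObjective (fun x => Ψ (x, a • y + b • y')) z (a • x + b • x') ≤
      ((a * α + b * β - a * b / 2 * ‖x - x'‖ ^ 2 : ℝ) : EReal) := by
  rw [proxObjective_le_coe_iff] at *
  have := hconv.le_coe ha hb hab hα hβ
  simp only [Prod.smul_mk, Prod.mk_add_mk] at this
  refine this.trans (le_of_eq ?_)
  rw [norm_sub_convexCombination_sq z x x' hab]
  congr 1
  ring

/-- The parametric Moreau envelope decreases at most linearly in the parameter. -/
theorem exists_sub_mul_norm_le_moreauEnvelope {Ψ : H × E → EReal} (hbot : ∀ p, Ψ p ≠ ⊥)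
    (hconv : IsConvex Ψ) (hlsc : LowerSemicontinuous Ψ) (z : H) :
    ∃ A B : ℝ, 0 ≤ B ∧
      ∀ y, ((A - B * ‖y‖ : ℝ) : EReal) ≤ moreauEnvelope (fun x => Ψ (x, y)) z := by
  obtain ⟨A, B, hB, hAB⟩ := exists_sub_mul_norm_le hbot hconv hlsc
  refine ⟨A - B * ‖z‖ - B ^ 2 / 2, B, hB, fun y => le_iInf fun x => ?_⟩
  rw [← EReal.le_of_forall_lt_iff_le]
  intro β hβ
  have hΨ : Ψ (x, y) ≤ ((β - 1 / 2 * ‖z - x‖ ^ 2 : ℝ) : EReal) :=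
    (proxObjective_le_coe_iff (φ := fun x => Ψ (x, y))).1 hβ.le
  have h := (hAB (x, y)).trans hΨ
  rw [EReal.coe_le_coe_iff] at h ⊢
  have h1 : ‖(x, y)‖ ≤ ‖x‖ + ‖y‖ := by
    rw [Prod.norm_mk]
    exact max_le (by linarith [norm_nonneg y]) (by linarith [norm_nonneg x])
  have h2 : ‖x‖ ≤ ‖z‖ + ‖z - x‖ := by
    have := norm_sub_norm_le x z
    rw [norm_sub_rev] at this; linarith
  have h3 : B * ‖(x, y)‖ ≤ B * (‖z‖ + ‖z - x‖ + ‖y‖) := by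
    gcongr; linarith
  have h4 := two_mul_le_add_sq B ‖z - x‖
  rw [mul_add, mul_add] at h3
  linarith

/-- Along parameters `yₙ → y` that realise the lower limit `c` of the envelope, near-minimizers
`xₙ` form a Cauchy sequence: the midpoints of the parameters also tend to `y`, so that the
objective at the midpoints cannot drop below `c` by more than a small amount, and strong convexity
applies. The limit of `xₙ` has objective at most `c` at the parameter `y`. -/
theorem exists_proxObjective_le_liminf [CompleteSpace H] {Ψ : H × E → EReal}
    (hbot : ∀ p, Ψ p ≠ ⊥) (hconv : IsConvex Ψ) (hlsc : LowerSemicontinuous Ψ) (z : H) (y : E)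
    (hy : liminf (fun y' => moreauEnvelope (fun x => Ψ (x, y')) z) (𝓝 y) ≠ ⊤) :
    ∃ x, proxObjective (fun x => Ψ (x, y)) z x ≤
      liminf (fun y' => moreauEnvelope (fun x => Ψ (x, y')) z) (𝓝 y) := by
  set V : E → EReal := fun y' => moreauEnvelope (fun x => Ψ (x, y')) z with hV
  obtain ⟨A, B, hB, hAB⟩ := exists_sub_mul_norm_le_moreauEnvelope hbot hconv hlsc z
  have hne_bot : liminf V (𝓝 y) ≠ ⊥ := by
    refine ne_bot_of_le_ne_bot (EReal.coe_ne_bot (A - B * (‖y‖ + 1)))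
      (le_liminf_of_le (by isBoundedDefault) ?_)
    filter_upwards [Metric.ball_mem_nhds y one_pos] with y' hy'
    refine le_trans ?_ (hAB y')
    rw [EReal.coe_le_coe_iff]
    rw [mem_ball_iff_norm] at hy'
    have : ‖y'‖ ≤ ‖y‖ + 1 := by linarith [norm_sub_norm_le y' y]
    gcongr
  obtain ⟨c, hc⟩ : ∃ c : ℝ, liminf V (𝓝 y) = c := ⟨_, (EReal.coe_toReal hy hne_bot).symm⟩
  rw [hc]
  have hseq : ∀ n : ℕ, ∃ p : H × E, dist p.2 y < 1 / ((n : ℝ) + 1) ∧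
      proxObjective (fun x => Ψ (x, p.2)) z p.1 < ((c + 1 / ((n : ℝ) + 1) : ℝ) : EReal) := by
    intro n
    have hn : 0 < 1 / ((n : ℝ) + 1) := by positivity
    have hlt : liminf V (𝓝 y) < ((c + 1 / ((n : ℝ) + 1) : ℝ) : EReal) := by
      rw [hc]; exact_mod_cast lt_add_of_pos_right c hn
    obtain ⟨y', hy', hd⟩ := ((frequently_lt_of_liminf_lt (by isBoundedDefault) hlt).and_eventually
      (Metric.ball_mem_nhds y hn)).exists
    obtain ⟨x', hx'⟩ := iInf_lt_iff.1 hy'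
    exact ⟨(x', y'), hd, hx'⟩
  choose p hpd hpV using hseq
  have hlim : Tendsto (fun n : ℕ => 1 / ((n : ℝ) + 1)) atTop (𝓝 0) :=
    tendsto_one_div_add_atTop_nhds_zero_nat
  have hcauchy : CauchySeq fun n => (p n).1 := by
    refine Metric.cauchySeq_iff.2 fun ε hε => ?_
    have hη : 0 < ε ^ 2 / 16 := by positivity
    have hlt : ((c - ε ^ 2 / 16 : ℝ) : EReal) < liminf V (𝓝 y) := by
      rw [hc]; exact_mod_cast sub_lt_self c hη
    obtain ⟨δ, hδ, hball⟩ := Metric.eventually_nhds_iff_ball.1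
      (eventually_lt_of_lt_liminf hlt (by isBoundedDefault))
    obtain ⟨N, hN⟩ := eventually_atTop.1 (hlim.eventually_lt_const (lt_min hη hδ))
    refine ⟨N, fun m hm n hn => ?_⟩
    have hmN := lt_min_iff.1 (hN m hm)
    have hnN := lt_min_iff.1 (hN n hn)
    have hmid := proxObjective_convexCombination_le hconv z (by norm_num : (0 : ℝ) < 1 / 2)
      (by norm_num : (0 : ℝ) < 1 / 2) (by norm_num) (hpV m).le (hpV n).le
    have hmem : (1 / 2 : ℝ) • (p m).2 + (1 / 2 : ℝ) • (p n).2 ∈ Metric.ball y δ :=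
      convex_ball y δ ((hpd m).trans hmN.2) ((hpd n).trans hnN.2) (by norm_num) (by norm_num)
        (by norm_num)
    have hlow := ((hball _ hmem).trans_le (iInf_le _ _)).trans_le hmid
    rw [EReal.coe_lt_coe_iff] at hlow
    rw [dist_eq_norm]
    refine lt_of_pow_lt_pow_left₀ 2 hε.le ?_
    linarith [hmN.1, hnN.1]
  obtain ⟨x, hx⟩ := cauchySeq_tendsto_of_complete hcauchy
  refine ⟨x, ?_⟩
  have hy_tendsto : Tendsto (fun n => (p n).2) atTop (𝓝 y) :=
    tendsto_iff_dist_tendsto_zero.2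
      (squeeze_zero (fun _ => dist_nonneg) (fun n => (hpd n).le) hlim)
  rw [← EReal.ge_of_forall_gt_iff_ge]
  intro β hβ
  have hev := (hx.prodMk_nhds hy_tendsto).eventually
    (lowerSemicontinuous_proxObjective hlsc z (x, y) β hβ)
  rw [EReal.coe_le_coe_iff]
  have hlim' : Tendsto (fun n : ℕ => c + 1 / ((n : ℝ) + 1)) atTop (𝓝 (c + 0)) :=
    hlim.const_add c
  rw [add_zero] at hlim'
  refine ge_of_tendsto hlim' ?_
  filter_upwards [hev] with n hn
  exact_mod_cast (hn.trans (hpV n)).le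

theorem lowerSemicontinuous_moreauEnvelope_param [CompleteSpace H] {Ψ : H × E → EReal}
    (hbot : ∀ p, Ψ p ≠ ⊥) (hconv : IsConvex Ψ) (hlsc : LowerSemicontinuous Ψ) (z : H) :
    LowerSemicontinuous fun y => moreauEnvelope (fun x => Ψ (x, y)) z := by
  refine lowerSemicontinuous_iff_le_liminf.2 fun y => ?_
  by_cases hy : liminf (fun y' => moreauEnvelope (fun x => Ψ (x, y')) z) (𝓝 y) = ⊤
  · rw [hy]; exact le_top
  · obtain ⟨x, hx⟩ := exists_proxObjective_le_liminf hbot hconv hlsc z y hy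
    exact (iInf_le _ x).trans hx

theorem convex_strictEpigraph_moreauEnvelope_param {Ψ : H × E → EReal} (hconv : IsConvex Ψ)
    (z : H) :
    Convex ℝ {q : E × ℝ | moreauEnvelope (fun x => Ψ (x, q.1)) z < q.2} := by
  refine convex_iff_forall_pos.2 fun q hq q' hq' a b ha hb hab => ?_
  rw [mem_ofPred_eq, moreauEnvelope, iInf_lt_iff] at hq hq'
  obtain ⟨x, hx⟩ := hq
  obtain ⟨x', hx'⟩ := hq'
  obtain ⟨α, hxα, hα⟩ := EReal.lt_iff_exists_real_btwn.1 hx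
  obtain ⟨β, hxβ, hβ⟩ := EReal.lt_iff_exists_real_btwn.1 hx'
  have h := proxObjective_convexCombination_le hconv z ha hb hab hxα.le hxβ.le
  refine ((iInf_le _ _).trans h).trans_lt ?_
  rw [EReal.coe_lt_coe_iff] at hα hβ ⊢
  have : 0 ≤ a * b / 2 * ‖x - x'‖ ^ 2 := by positivity
  have h1 := mul_lt_mul_of_pos_left hα ha
  have h2 := mul_lt_mul_of_pos_left hβ hb
  simp only [Prod.snd_add, Prod.smul_snd, smul_eq_mul]
  linarith

theorem existsUnique_argmin_proxObjective [CompleteSpace H] {f : H → EReal}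
    (hbot : ∀ x, f x ≠ ⊥) (hconv : IsConvex f) (hlsc : LowerSemicontinuous f)
    (hdom : (dom f).Nonempty) (z : H) : ∃! p, p ∈ Argmin (proxObjective f z) := by
  -- The one-parameter family that does not depend on the parameter `y : ℝ`.
  have hconv' : IsConvex fun p : H × ℝ => f p.1 := fun p q a b ha hb hab =>
    hconv p.1 q.1 a b ha hb hab
  have hlsc' : LowerSemicontinuous fun p : H × ℝ => f p.1 := hlsc.comp continuous_fst
  obtain ⟨x₀, hx₀⟩ := hdom
  have htop : proxObjective f z x₀ < ⊤ := EReal.add_lt_top hx₀.ne (EReal.coe_ne_top _)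
  have hlt : moreauEnvelope f z < ⊤ := (iInf_le _ x₀).trans_lt htop
  obtain ⟨p, hp⟩ := exists_proxObjective_le_liminf (fun p => hbot p.1) hconv' hlsc' z (0 : ℝ)
    (by simpa using hlt.ne)
  simp only [liminf_const] at hp
  refine ⟨p, ⟨hp.trans_lt hlt, fun y => hp.trans (iInf_le _ y)⟩, fun q hq => ?_⟩
  have hpq : proxObjective f z q ≤ proxObjective f z p := hq.2 p
  obtain ⟨c, hc⟩ : ∃ c : ℝ, proxObjective f z q = c := by
    refine ⟨_, (EReal.coe_toReal hq.1.ne ?_).symm⟩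
    exact EReal.add_ne_bot_iff.2 ⟨hbot q, EReal.coe_ne_bot _⟩
  have hmid := proxObjective_convexCombination_le hconv' z (y := (0 : ℝ)) (y' := 0)
    (by norm_num : (0 : ℝ) < 1 / 2) (by norm_num : (0 : ℝ) < 1 / 2) (by norm_num)
    ((hp.trans (iInf_le _ q)).trans hc.le) hc.le
  have hle := (hc.ge.trans (hq.2 _)).trans hmid
  rw [EReal.coe_le_coe_iff] at hle
  have : ‖p - q‖ ^ 2 ≤ 0 := by linarith
  exact (sub_eq_zero.1 (norm_eq_zero.1 (pow_eq_zero_iff two_ne_zero |>.1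
    (le_antisymm this (sq_nonneg _))))).symm

end ParametricEnvelope

/-! ### Subgradients from Baire's theorem -/

section Subgradient

/-- A lower semicontinuous function on a Banach space with convex strict epigraph, whose domain is
absorbing, has a continuous affine minorant that is exact at `0`. Baire's theorem gives a ball on
which the function is bounded above, so that the strict epigraph has nonempty interior and can be
separated from `(0, W 0)`; the separating hyperplane is not vertical because the domain is
absorbing. -/
theorem exists_continuousLinear_add_le {F : Type*} [NormedAddCommGroup F] [NormedSpace ℝ F]
    [CompleteSpace F] {W : F → EReal} (hlsc : LowerSemicontinuous W)
    (hconv : Convex ℝ {q : F × ℝ | W q.1 < q.2}) {w : ℝ} (hw : W 0 = w)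
    (habs : ∀ y, ∃ t : ℝ, 0 < t ∧ W (t • y) < ⊤) :
    ∃ φ : StrongDual ℝ F, ∀ y, ((w + φ y : ℝ) : EReal) ≤ W y := by
  have hseg : ∀ y : F, ∀ α : ℝ, ∀ t : ℝ, w < α → W y < α → 0 < t → t ≤ 1 → W (t • y) < α := by
    intro y α t hα hy ht ht1
    have h0 : ((0 : F), α) ∈ {q : F × ℝ | W q.1 < q.2} := by
      simp only [mem_ofPred_eq, hw]; exact_mod_cast hα
    have h1 : (y, α) ∈ {q : F × ℝ | W q.1 < q.2} := hy
    have := hconv h1 h0 ht.le (sub_nonneg.2 ht1) (by ring)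
    simp only [Prod.smul_mk, Prod.mk_add_mk, mem_ofPred_eq, smul_zero, add_zero, smul_eq_mul] at this
    convert this using 2
    ring
  -- Baire: `W` is bounded above on a nonempty open set.
  obtain ⟨n, x₁, hx₁⟩ := nonempty_interior_of_iUnion_of_closed
    (f := fun n : ℕ => {y : F | W (((n : ℝ) + 1)⁻¹ • y) ≤ ((n : ℝ) : EReal)})
    (fun n => (hlsc.comp (continuous_const_smul (((n : ℝ) + 1)⁻¹))).isClosed_preimage _) (by
      refine eq_univ_of_forall fun y => mem_iUnion.2 ?_
      obtain ⟨t, ht, hty⟩ := habs y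
      obtain ⟨α, hα, -⟩ := EReal.lt_iff_exists_real_btwn.1 hty
      obtain ⟨n, hn⟩ := exists_nat_gt (max (max w α) t⁻¹)
      obtain ⟨hn, hnt⟩ := max_lt_iff.1 hn
      obtain ⟨hnw, hnα⟩ := max_lt_iff.1 hn
      refine ⟨n, ?_⟩
      have hn0 : (0 : ℝ) < (n : ℝ) + 1 := by positivity
      have hs : 0 < ((n : ℝ) + 1)⁻¹ / t := by positivity
      have hs1 : ((n : ℝ) + 1)⁻¹ / t ≤ 1 := by
        rw [div_le_one ht]
        exact inv_le_of_inv_le₀ ht (by linarith)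
      have := hseg (t • y) n _ hnw (hα.trans (by exact_mod_cast hnα)) hs hs1
      rw [smul_smul, div_mul_cancel₀ _ ht.ne'] at this
      exact this.le)
  have hn0 : (0 : ℝ) < (n : ℝ) + 1 := by positivity
  have hint : (interior {q : F × ℝ | W q.1 < q.2}).Nonempty := by
    refine ⟨(((n : ℝ) + 1)⁻¹ • x₁, (n : ℝ) + 1), mem_interior_iff_mem_nhds.2 ?_⟩
    have hcont : Tendsto (fun q : F × ℝ => ((n : ℝ) + 1) • q.1)
        (𝓝 (((n : ℝ) + 1)⁻¹ • x₁, (n : ℝ) + 1)) (𝓝 x₁) := by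
      have : Continuous fun q : F × ℝ => ((n : ℝ) + 1) • q.1 := by fun_prop
      simpa [smul_smul, hn0.ne'] using this.tendsto (((n : ℝ) + 1)⁻¹ • x₁, (n : ℝ) + 1)
    filter_upwards [hcont (mem_interior_iff_mem_nhds.1 hx₁),
      continuous_snd.tendsto (((n : ℝ) + 1)⁻¹ • x₁, (n : ℝ) + 1) (lt_mem_nhds (lt_add_one (n : ℝ)))]
      with q hq hq2
    simp only [mem_preimage, mem_ofPred_eq, smul_smul, inv_mul_cancel₀ hn0.ne', one_smul] at hq hq2 ⊢
    exact hq.trans_lt (by exact_mod_cast hq2)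
  obtain ⟨ℓ, hℓ⟩ := geometric_hahn_banach_open_point hconv.interior isOpen_interior
    (x := ((0 : F), w)) (fun h => by
      have := interior_subset h
      simp [hw] at this)
  have hle : ∀ q : F × ℝ, W q.1 < q.2 → ℓ q ≤ ℓ ((0 : F), w) := by
    intro q hq
    have hmem : q ∈ closure (interior {q : F × ℝ | W q.1 < q.2}) := by
      rw [hconv.closure_interior_eq_closure_of_nonempty_interior hint]
      exact subset_closure hq
    exact closure_minimal (fun a ha => (hℓ a ha).le) (isClosed_le ℓ.continuous continuous_const)
      hmem
  obtain ⟨s, hs⟩ : ∃ s : ℝ, s = ℓ ((0 : F), (1 : ℝ)) := ⟨_, rfl⟩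
  have hsplit : ∀ y t, ℓ (y, t) = ℓ (y, 0) + s * t := by
    intro y t
    have : (y, t) = (y, (0 : ℝ)) + t • ((0 : F), (1 : ℝ)) := by simp
    rw [this, map_add, map_smul, hs, smul_eq_mul, mul_comm]
  have hzero : ℓ ((0 : F), (0 : ℝ)) = 0 := map_zero ℓ
  have hs_nonpos : s ≤ 0 := by
    have := hle ((0 : F), w + 1) (by simp only [hw]; exact_mod_cast lt_add_one w)
    rw [hsplit, hsplit 0 w] at this
    linarith
  have hs_neg : s < 0 := by
    refine lt_of_le_of_ne hs_nonpos fun hs0 => ?_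
    have hneg : ∀ y, ℓ (y, (0 : ℝ)) ≤ 0 := by
      intro y
      obtain ⟨t, ht, hty⟩ := habs y
      obtain ⟨α, hα, -⟩ := EReal.lt_iff_exists_real_btwn.1 hty
      have h1 := hle (t • y, α) hα
      have h2 : ((t • y, (0 : ℝ)) : F × ℝ) = t • (y, (0 : ℝ)) := by simp
      rw [hsplit, hsplit 0 w, hs0, h2, map_smul, hzero, smul_eq_mul] at h1
      by_contra! hcon
      nlinarith
    obtain ⟨q, hq⟩ := hint
    have h1 := hℓ q hq
    have h2 := hneg (-q.1)
    have h3 : ((-q.1, (0 : ℝ)) : F × ℝ) = -(q.1, (0 : ℝ)) := by simp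
    rw [h3, map_neg] at h2
    have h4 := hsplit q.1 q.2
    rw [hsplit 0 w, hs0, hzero] at h1
    rw [hs0] at h4
    simp only [Prod.mk.eta] at h4
    linarith
  refine ⟨(-s)⁻¹ • ℓ.comp (ContinuousLinearMap.inl ℝ F ℝ), fun y => ?_⟩
  rw [← EReal.le_of_forall_lt_iff_le]
  intro t ht
  have h1 := hle (y, t) ht
  rw [hsplit, hsplit 0 w, hzero] at h1
  rw [EReal.coe_le_coe_iff]
  simp only [_root_.smul_apply, ContinuousLinearMap.comp_apply,
    ContinuousLinearMap.inl_apply, smul_eq_mul]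
  have h2 : (-s)⁻¹ * ℓ (y, 0) ≤ t - w := by
    rw [inv_mul_le_iff₀ (neg_pos.2 hs_neg)]
    linarith
  linarith

end Subgradient

/-! ### Conjugates -/

section Conjugate

variable {E : Type*} [NormedAddCommGroup E] [InnerProductSpace ℝ E]

theorem coe_sub_le_coe_iff {a c : ℝ} {x : EReal} :
    (a : EReal) - x ≤ c ↔ ((a - c : ℝ) : EReal) ≤ x := by
  induction x with
  | bot =>
    simp only [EReal.coe_sub_bot, top_le_iff, EReal.coe_ne_top, le_bot_iff, EReal.coe_ne_bot]
  | top => simp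
  | coe b => norm_cast; constructor <;> intro h <;> linarith

theorem conj_le_coe_iff {φ : E → EReal} {u : E} {c : ℝ} :
    conj φ u ≤ c ↔ ∀ x, ((inner ℝ x u - c : ℝ) : EReal) ≤ φ x := by
  rw [conj, iSup_le_iff]
  exact forall_congr' fun x => coe_sub_le_coe_iff

theorem coe_le_conj {φ : E → EReal} {x u : E} {a : ℝ} (hx : φ x ≤ a) :
    ((inner ℝ x u - a : ℝ) : EReal) ≤ conj φ u := by
  refine le_trans ?_ (le_iSup (fun x => ((inner ℝ x u : ℝ) : EReal) - φ x) x)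
  rw [EReal.coe_sub]
  exact EReal.sub_le_sub le_rfl hx

theorem conj_ne_bot {φ : E → EReal} (hdom : (dom φ).Nonempty) (u : E) : conj φ u ≠ ⊥ := by
  obtain ⟨x, hx⟩ := hdom
  obtain ⟨a, ha, -⟩ := EReal.lt_iff_exists_real_btwn.1 hx
  exact ne_bot_of_le_ne_bot (EReal.coe_ne_bot _) (coe_le_conj ha.le)

theorem conj_convexCombination_le_coe {φ : E → EReal} {u v : E} {a b α β : ℝ} (ha : 0 ≤ a)
    (hb : 0 ≤ b) (hab : a + b = 1) (hu : conj φ u ≤ α) (hv : conj φ v ≤ β) :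
    conj φ (a • u + b • v) ≤ ((a * α + b * β : ℝ) : EReal) := by
  rw [conj_le_coe_iff] at *
  intro x
  obtain ⟨s, hs⟩ : ∃ s : ℝ, s = max (inner ℝ x u - α) (inner ℝ x v - β) := ⟨_, rfl⟩
  have hsx : (s : EReal) ≤ φ x := by
    rw [hs, EReal.coe_strictMono.monotone.map_max]
    exact max_le (hu x) (hv x)
  refine le_trans ?_ hsx
  rw [EReal.coe_le_coe_iff, inner_add_right, real_inner_smul_right, real_inner_smul_right]
  have h1 := mul_le_mul_of_nonneg_left (hs ▸ le_max_left _ _ : inner ℝ x u - α ≤ s) ha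
  have h2 := mul_le_mul_of_nonneg_left (hs ▸ le_max_right _ _ : inner ℝ x v - β ≤ s) hb
  have h3 : a * s + b * s = s := by rw [← add_mul, hab, one_mul]
  linarith

theorem conj_comp_sub_right (g : E → EReal) (r v : E) :
    conj (fun y => g (y - r)) v = conj g v + ((inner ℝ v r : ℝ) : EReal) := by
  have key : ∀ c : ℝ, conj (fun y => g (y - r)) v ≤ c ↔
      conj g v ≤ ((c - inner ℝ v r : ℝ) : EReal) := by
    intro c
    rw [conj_le_coe_iff, conj_le_coe_iff]
    refine ((Equiv.subRight r).forall_congr fun y => ?_)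
    rw [Equiv.subRight_apply, inner_sub_left, real_inner_comm v r, sub_sub_sub_cancel_right]
  have key' : ∀ c : ℝ, conj (fun y => g (y - r)) v ≤ c ↔
      conj g v + ((inner ℝ v r : ℝ) : EReal) ≤ c := by
    intro c
    rw [key c]
    induction conj g v with
    | bot => simp
    | top => rw [EReal.top_add_coe]; simp only [top_le_iff, EReal.coe_ne_top]
    | coe b => norm_cast; constructor <;> intro h <;> linarith
  refine le_antisymm ?_ ?_
  · exact EReal.le_of_forall_lt_iff_le.1 fun c hc => (key' c).2 hc.le
  · exact EReal.le_of_forall_lt_iff_le.1 fun c hc => (key' c).1 hc.le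

end Conjugate

/-! ### Proximal points and the envelope of the conjugate -/

theorem prox_mem_argmin {H : Type*} [NormedAddCommGroup H] {f : H → EReal} {w : H}
    (h : ∃! p, p ∈ Argmin (proxObjective f w)) : prox f w ∈ Argmin (proxObjective f w) := by
  rw [prox, dif_pos h]
  exact h.choose_spec.1

section Prox

variable {H : Type*} [NormedAddCommGroup H] [InnerProductSpace ℝ H]

/-- The limit `t → 0` in a first-order optimality condition. -/
theorem nonneg_of_forall_nonneg_mul_add_sq_mul {a b : ℝ}
    (h : ∀ t : ℝ, 0 < t → t < 1 → 0 ≤ t * a + t ^ 2 * b) : 0 ≤ a := by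
  have hlim : Tendsto (fun t : ℝ => a + t * b) (𝓝[>] 0) (𝓝 (a + 0 * b)) :=
    (Continuous.tendsto (by fun_prop) 0).mono_left nhdsWithin_le_nhds
  rw [zero_mul, add_zero] at hlim
  refine ge_of_tendsto hlim ?_
  filter_upwards [Ioo_mem_nhdsGT (zero_lt_one : (0 : ℝ) < 1)] with t ht
  have := h t ht.1 ht.2
  have h2 : 0 ≤ t * (a + t * b) := by linarith
  exact nonneg_of_mul_nonneg_right h2 ht.1

/-- The point `p = prox f w` satisfies `w - p ∈ ∂f(p)`, and `f p` is finite. -/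
theorem exists_coe_eq_prox {f : H → EReal} (hbot : ∀ x, f x ≠ ⊥) (hconv : IsConvex f) {w : H}
    (h : ∃! p, p ∈ Argmin (proxObjective f w)) :
    ∃ a : ℝ, f (prox f w) = a ∧
      ∀ x, ((a + inner ℝ (x - prox f w) (w - prox f w) : ℝ) : EReal) ≤ f x := by
  obtain ⟨hdom, hmin⟩ := prox_mem_argmin h
  generalize prox f w = p at *
  have hp : f p ≠ ⊤ := by
    intro htop
    rw [dom, mem_ofPred_eq, proxObjective, htop, EReal.top_add_coe] at hdom
    exact lt_irrefl _ hdom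
  obtain ⟨a, ha⟩ : ∃ a : ℝ, f p = a := ⟨_, (EReal.coe_toReal hp (hbot p)).symm⟩
  refine ⟨a, ha, fun x => EReal.le_of_forall_lt_iff_le.1 fun β hβ => ?_⟩
  rw [EReal.coe_le_coe_iff]
  suffices 0 ≤ β - a - inner ℝ (x - p) (w - p) by linarith
  refine nonneg_of_forall_nonneg_mul_add_sq_mul (b := 1 / 2 * ‖x - p‖ ^ 2) fun t ht ht1 => ?_
  have hle := hconv.le_coe (sub_pos.2 ht1) ht (by ring) ha.le hβ.le
  have hp' : proxObjective f w p = ((a + 1 / 2 * ‖w - p‖ ^ 2 : ℝ) : EReal) := by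
    rw [proxObjective, ha, EReal.coe_add]
  have h1 : ((a + 1 / 2 * ‖w - p‖ ^ 2 : ℝ) : EReal) ≤
      (((1 - t) * a + t * β) + 1 / 2 * ‖w - ((1 - t) • p + t • x)‖ ^ 2 : ℝ) := by
    rw [← hp', EReal.coe_add]
    exact (hmin _).trans (add_le_add hle le_rfl)
  rw [EReal.coe_le_coe_iff] at h1
  have h2 : w - ((1 - t) • p + t • x) = (w - p) - t • (x - p) := by module
  rw [h2, norm_sub_sq_real (w - p), norm_smul, mul_pow, Real.norm_eq_abs, sq_abs,
    real_inner_smul_right, real_inner_comm (x - p) (w - p)] at h1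
  linarith

/-- The easy half of `(f + ½‖·‖²)* = (f*)~`, a consequence of the Fenchel-Young inequality. -/
theorem coe_le_moreauEnvelope_conj {f : H → EReal} {x : H} {a : ℝ} (hx : f x ≤ a) (w : H) :
    ((inner ℝ x w - a - 1 / 2 * ‖x‖ ^ 2 : ℝ) : EReal) ≤ moreauEnvelope (conj f) w := by
  refine le_iInf fun y => le_trans ?_ (add_le_add (coe_le_conj (u := y) hx) le_rfl)
  rw [← EReal.coe_add, EReal.coe_le_coe_iff]
  have h0 : (0 : ℝ) ≤ ‖x - (w - y)‖ ^ 2 := sq_nonneg _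
  rw [norm_sub_sq_real, inner_sub_right] at h0
  linarith

/-- The envelope of `f*` at `w` is attained at `w - prox f w`: this is Moreau's decomposition. -/
theorem moreauEnvelope_conj_eq {f : H → EReal} (hbot : ∀ x, f x ≠ ⊥) (hconv : IsConvex f) {w : H}
    (h : ∃! p, p ∈ Argmin (proxObjective f w)) :
    moreauEnvelope (conj f) w =
      ((inner ℝ (prox f w) w - (f (prox f w)).toReal - 1 / 2 * ‖prox f w‖ ^ 2 : ℝ) : EReal) := by
  obtain ⟨a, ha, hsub⟩ := exists_coe_eq_prox hbot hconv h
  generalize prox f w = p at *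
  rw [ha, EReal.toReal_coe]
  refine le_antisymm ?_ (coe_le_moreauEnvelope_conj ha.le w)
  refine (iInf_le _ (w - p)).trans (proxObjective_le_coe_iff.2 (conj_le_coe_iff.2 fun x => ?_))
  refine le_trans (le_of_eq ?_) (hsub x)
  rw [sub_sub_cancel, inner_sub_left, inner_sub_right p w p, real_inner_self_eq_norm_sq]
  congr 1
  ring

/-- The conjugate of `f + ½‖· - z‖²` is, up to a translation and a constant, the Moreau envelope
of `f*`. -/
theorem conj_add_sq_norm_sub {f : H → EReal} (hbot : ∀ x, f x ≠ ⊥) (hconv : IsConvex f) {z u : H}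
    (h : ∃! p, p ∈ Argmin (proxObjective f (z + u))) :
    conj (fun x => f x + ((1 / 2 * ‖x - z‖ ^ 2 : ℝ) : EReal)) u =
      moreauEnvelope (conj f) (z + u) - ((1 / 2 * ‖z‖ ^ 2 : ℝ) : EReal) := by
  rw [moreauEnvelope_conj_eq hbot hconv h, ← EReal.coe_sub]
  obtain ⟨a, ha, hsub⟩ := exists_coe_eq_prox hbot hconv h
  generalize prox f (z + u) = p at *
  rw [ha, EReal.toReal_coe]
  refine le_antisymm (conj_le_coe_iff.2 fun x => ?_) ?_
  · refine le_trans ?_ (add_le_add (hsub x) le_rfl)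
    rw [← EReal.coe_add, EReal.coe_le_coe_iff]
    have h0 : (0 : ℝ) ≤ ‖x - p‖ ^ 2 := sq_nonneg _
    rw [norm_sub_sq_real] at h0 ⊢
    simp only [inner_sub_left, inner_sub_right, inner_add_right, real_inner_self_eq_norm_sq]
    linarith
  · have hp : f p + ((1 / 2 * ‖p - z‖ ^ 2 : ℝ) : EReal) ≤
        ((a + 1 / 2 * ‖p - z‖ ^ 2 : ℝ) : EReal) := by
      rw [ha, EReal.coe_add]
    refine le_trans ?_ (coe_le_conj (φ := fun x => f x + ((1 / 2 * ‖x - z‖ ^ 2 : ℝ) : EReal)) hp)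
    rw [EReal.coe_le_coe_iff, norm_sub_sq_real, inner_add_right]
    linarith

/-- `prox f w` is a subgradient of the envelope of `f*` at `w`. -/
theorem moreauEnvelope_conj_add_inner_le {f : H → EReal} (hbot : ∀ x, f x ≠ ⊥)
    (hconv : IsConvex f) (hprox : ∀ w, ∃! p, p ∈ Argmin (proxObjective f w)) (w w' : H) :
    moreauEnvelope (conj f) w + ((inner ℝ (w' - w) (prox f w) : ℝ) : EReal) ≤
      moreauEnvelope (conj f) w' := by
  obtain ⟨a, ha, -⟩ := exists_coe_eq_prox hbot hconv (hprox w)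
  rw [moreauEnvelope_conj_eq hbot hconv (hprox w)]
  generalize prox f w = p at *
  rw [ha, EReal.toReal_coe, ← EReal.coe_add]
  refine le_trans (le_of_eq ?_) (coe_le_moreauEnvelope_conj ha.le w')
  rw [inner_sub_left, real_inner_comm p w', real_inner_comm p w]
  congr 1
  ring

/-- The quadratic upper bound matching `moreauEnvelope_conj_add_inner_le`; together they say that
`prox f w` is the gradient at `w` of the envelope of `f*`. -/
theorem moreauEnvelope_conj_le_add_inner {f : H → EReal} (hbot : ∀ x, f x ≠ ⊥)
    (hconv : IsConvex f) (hprox : ∀ w, ∃! p, p ∈ Argmin (proxObjective f w)) (w w' : H) :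
    moreauEnvelope (conj f) w' ≤ moreauEnvelope (conj f) w +
      ((inner ℝ (w' - w) (prox f w) + 1 / 2 * ‖w' - w‖ ^ 2 : ℝ) : EReal) := by
  obtain ⟨a, ha, hsub⟩ := exists_coe_eq_prox hbot hconv (hprox w)
  rw [moreauEnvelope_conj_eq hbot hconv (hprox w)]
  generalize prox f w = p at *
  rw [ha, EReal.toReal_coe, ← EReal.coe_add]
  refine (iInf_le _ (w - p)).trans (proxObjective_le_coe_iff.2 (conj_le_coe_iff.2 fun x => ?_))
  refine le_trans (le_of_eq ?_) (hsub x)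
  have h1 : w' - (w - p) = (w' - w) + p := by abel
  rw [h1, norm_add_sq_real, inner_sub_left x p, inner_sub_right p w p, real_inner_self_eq_norm_sq]
  congr 1
  ring

end Prox

/-! ### The dual problem -/

theorem argmin_sub_coe {E : Type*} (D : E → EReal) (c : ℝ) :
    Argmin (fun v => D v - (c : EReal)) = Argmin D := by
  have hle : ∀ a b : EReal, a - (c : EReal) ≤ b - (c : EReal) ↔ a ≤ b := fun a b =>
    ⟨fun h => by simpa only [EReal.sub_add_cancel] using add_le_add h (le_refl (c : EReal)),
      fun h => EReal.sub_le_sub h le_rfl⟩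
  ext v
  simp only [Argmin, dom, mem_ofPred_eq, hle, lt_top_iff_ne_top, ne_eq]
  refine and_congr_left fun _ => not_congr ?_
  induction D v with
  | bot => simp
  | top => simp
  | coe b => simp only [← EReal.coe_sub, EReal.coe_ne_top]

theorem lt_top_of_proxObjective_lt_top {H G : Type*} [NormedAddCommGroup H] {f : H → EReal}
    {g : G → EReal} (hf_bot : ∀ x, f x ≠ ⊥) (hg_bot : ∀ y, g y ≠ ⊥) {z x : H}
    {u : H → G} (h : proxObjective (fun x => f x + g (u x)) z x < ⊤) :
    f x < ⊤ ∧ g (u x) < ⊤ := by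
  have h1 : f x + g (u x) ≠ ⊤ := by
    intro htop
    rw [proxObjective, htop, EReal.top_add_coe] at h
    exact lt_irrefl _ h
  have h2 := (EReal.add_ne_top_iff_ne_top₂ (hf_bot x) (hg_bot _)).1 h1
  exact ⟨h2.1.lt_top, h2.2.lt_top⟩

section Duality

variable {H G : Type*} [NormedAddCommGroup H] [InnerProductSpace ℝ H]
  [NormedAddCommGroup G] [InnerProductSpace ℝ G] {f : H → EReal} {g : G → EReal}

theorem isConvex_perturbation (hf_conv : IsConvex f) (hg_conv : IsConvex g) (L : H →L[ℝ] G)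
    (r : G) : IsConvex fun p : H × G => f p.1 + g (L p.1 - r - p.2) := by
  intro p q a b ha hb hab
  have ha' : (0 : EReal) ≤ a := by exact_mod_cast ha.le
  have hb' : (0 : EReal) ≤ b := by exact_mod_cast hb.le
  have h1 : L (a • p + b • q).1 - r - (a • p + b • q).2 =
      a • (L p.1 - r - p.2) + b • (L q.1 - r - q.2) := by
    obtain rfl : b = 1 - a := by linarith
    simp only [Prod.fst_add, Prod.smul_fst, Prod.snd_add, Prod.smul_snd, map_add, map_smul]
    module
  beta_reduce
  rw [EReal.left_distrib_of_nonneg_of_ne_top ha' (EReal.coe_ne_top a),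
    EReal.left_distrib_of_nonneg_of_ne_top hb' (EReal.coe_ne_top b), add_add_add_comm, h1]
  exact add_le_add (hf_conv p.1 q.1 a b ha hb hab) (hg_conv _ _ a b ha hb hab)

theorem lowerSemicontinuous_perturbation (hf_bot : ∀ x, f x ≠ ⊥) (hf_lsc : LowerSemicontinuous f)
    (hg_bot : ∀ y, g y ≠ ⊥) (hg_lsc : LowerSemicontinuous g) (L : H →L[ℝ] G) (r : G) :
    LowerSemicontinuous fun p : H × G => f p.1 + g (L p.1 - r - p.2) :=
  LowerSemicontinuous.add' (hf_lsc.comp continuous_fst)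
    (hg_lsc.comp (by fun_prop : Continuous fun p : H × G => L p.1 - r - p.2))
    fun p => EReal.continuousAt_add (Or.inr (hg_bot _)) (Or.inl (hf_bot _))

/-- The value function `y ↦ inf_x (f(x) + g(L x - r - y) + ½‖x - z‖²)` of the primal problem has a
subgradient at `0`. Its domain is `L(dom f) - dom g - r`, so the qualification condition says that
this domain is absorbing in the closed subspace that it spans, and that subspace is where Baire's
theorem applies; outside it the value function is `⊤`. -/
theorem exists_subgradient_value [CompleteSpace H] [CompleteSpace G]
    (hf_bot : ∀ x, f x ≠ ⊥) (hf_conv : IsConvex f) (hf_lsc : LowerSemicontinuous f)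
    (hg_bot : ∀ y, g y ≠ ⊥) (hg_conv : IsConvex g) (hg_lsc : LowerSemicontinuous g)
    (L : H →L[ℝ] G) (z : H) (r : G) (hr : r ∈ sri (L '' dom f - dom g)) :
    ∃ (v : G) (μ : ℝ), moreauEnvelope (fun x => f x + g (L x - r)) z = μ ∧
      ∀ y, ((μ + inner ℝ v y : ℝ) : EReal) ≤
        moreauEnvelope (fun x => f x + g (L x - r - y)) z := by
  set V : G → EReal := fun y => moreauEnvelope (fun x => f x + g (L x - r - y)) z with hV
  set C : Set G := L '' dom f - dom g with hC
  have hΨ_bot : ∀ p : H × G, f p.1 + g (L p.1 - r - p.2) ≠ ⊥ := fun p =>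
    EReal.add_ne_bot_iff.2 ⟨hf_bot _, hg_bot _⟩
  have hΨ_conv := isConvex_perturbation hf_conv hg_conv L r
  have hΨ_lsc := lowerSemicontinuous_perturbation hf_bot hf_lsc hg_bot hg_lsc L r
  have hV_lsc : LowerSemicontinuous V :=
    lowerSemicontinuous_moreauEnvelope_param hΨ_bot hΨ_conv hΨ_lsc z
  have hV_conv : Convex ℝ {q : G × ℝ | V q.1 < q.2} :=
    convex_strictEpigraph_moreauEnvelope_param hΨ_conv z
  have hV_dom : ∀ y, V y < ⊤ ↔ y ∈ C - {r} := by
    intro y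
    simp only [hV, moreauEnvelope, iInf_lt_iff]
    constructor
    · rintro ⟨x, hx⟩
      obtain ⟨h1, h2⟩ := lt_top_of_proxObjective_lt_top (u := fun x => L x - r - y) hf_bot hg_bot hx
      exact ⟨_, ⟨L x, ⟨x, h1, rfl⟩, L x - r - y, h2, rfl⟩, r, rfl, by simp only; abel⟩
    · rintro ⟨_, ⟨_, ⟨x, hx, rfl⟩, q, hq, rfl⟩, r', hr', rfl⟩
      have hq' : g (L x - r - (L x - q - r')) < ⊤ := by
        have : L x - r - (L x - q - r') = q := by rw [mem_singleton_iff.1 hr']; abel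
        rw [this]; exact hq
      exact ⟨x, EReal.add_lt_top (EReal.add_lt_top (LT.lt.ne hx) hq'.ne).ne (EReal.coe_ne_top _)⟩
  obtain ⟨A, B, -, hAB⟩ := exists_sub_mul_norm_le_moreauEnvelope hΨ_bot hΨ_conv hΨ_lsc z
  have hV0_top : V 0 < ⊤ := (hV_dom 0).2 ⟨r, hr.1, r, rfl, sub_self r⟩
  have hV0_bot : V 0 ≠ ⊥ := ne_bot_of_le_ne_bot (EReal.coe_ne_bot _) (hAB 0)
  obtain ⟨μ, hμ⟩ : ∃ μ : ℝ, V 0 = μ := ⟨_, (EReal.coe_toReal hV0_top.ne hV0_bot).symm⟩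
  let F : Submodule ℝ G := (Submodule.span ℝ (C - {r})).topologicalClosure
  have hF : (F : Set G) = cone (C - {r}) := by
    rw [hr.2]; exact Submodule.topologicalClosure_coe _
  have : CompleteSpace F := (Submodule.isClosed_topologicalClosure _).completeSpace_coe
  obtain ⟨φ, hφ⟩ := exists_continuousLinear_add_le (W := fun y : F => V y) (w := μ)
    (hV_lsc.comp continuous_subtype_val)
    (fun q hq q' hq' a b ha hb hab =>
      hV_conv (x := ((q.1 : G), q.2)) hq (y := ((q'.1 : G), q'.2)) hq' ha hb hab)
    hμ (by
      rintro ⟨y, hy⟩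
      obtain ⟨c, hc, d, hd, rfl⟩ : y ∈ cone (C - {r}) := hF ▸ hy
      refine ⟨c⁻¹, inv_pos.2 hc, (hV_dom _).2 ?_⟩
      simpa only [SetLike.mk_smul_mk, smul_smul, inv_mul_cancel₀ hc.ne', one_smul] using hd)
  refine ⟨((InnerProductSpace.toDual ℝ F).symm φ : F), μ, ?_, fun y => ?_⟩
  · simpa only [hV, sub_zero] using hμ
  · by_cases hy : y ∈ F
    · have := hφ ⟨y, hy⟩
      rwa [← InnerProductSpace.toDual_symm_apply, Submodule.coe_inner] at this
    · have : ¬ V y < ⊤ := fun h => hy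
        (Submodule.le_topologicalClosure _ (Submodule.subset_span ((hV_dom y).1 h)))
      rw [not_lt_top_iff] at this
      exact le_top.trans this.ge

variable [CompleteSpace H] [CompleteSpace G]

theorem fenchelDualObjective_eq (hf_bot : ∀ x, f x ≠ ⊥) (hf_conv : IsConvex f)
    (hprox : ∀ w, ∃! p, p ∈ Argmin (proxObjective f w)) (L : H →L[ℝ] G) (z : H) (r v : G) :
    fenchelDualObjective (fun x => f x + ((1 / 2 * ‖x - z‖ ^ 2 : ℝ) : EReal))
        (fun y => g (y - r)) L v =
      dualObjective f g L z r v - ((1 / 2 * ‖z‖ ^ 2 : ℝ) : EReal) := by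
  rw [fenchelDualObjective, dualObjective, conj_comp_sub_right,
    conj_add_sq_norm_sub hf_bot hf_conv (hprox _), ← sub_eq_add_neg,
    sub_eq_add_neg _ (Real.toEReal _), sub_eq_add_neg _ (Real.toEReal _), add_right_comm]
  simp only [add_assoc]

/-- Weak duality, up to the constant `½‖z‖²`. -/
theorem coe_le_dualObjective {L : H →L[ℝ] G} {z x : H} {r : G} {a b : ℝ} (ha : f x ≤ a)
    (hb : g (L x - r) ≤ b) (v : G) :
    ((1 / 2 * ‖z‖ ^ 2 - (a + b + 1 / 2 * ‖z - x‖ ^ 2) : ℝ) : EReal) ≤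
      dualObjective f g L z r v := by
  refine le_trans (le_of_eq ?_) (add_le_add (add_le_add
    (coe_le_moreauEnvelope_conj ha (z - ContinuousLinearMap.adjoint L v))
    (coe_le_conj (u := v) hb)) le_rfl)
  rw [← EReal.coe_add, ← EReal.coe_add]
  congr 1
  rw [norm_sub_sq_real, inner_sub_right, inner_sub_left, ContinuousLinearMap.adjoint_inner_right,
    real_inner_comm x z, real_inner_comm v r]
  ring

/-- Strong duality: minus the subgradient of the value function solves the dual problem. -/
theorem argmin_dualObjective_nonempty
    (hf_bot : ∀ x, f x ≠ ⊥) (hf_conv : IsConvex f) (hf_lsc : LowerSemicontinuous f)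
    (hg_bot : ∀ y, g y ≠ ⊥) (hg_conv : IsConvex g) (hg_lsc : LowerSemicontinuous g)
    (hprox : ∀ w, ∃! p, p ∈ Argmin (proxObjective f w))
    (L : H →L[ℝ] G) (z : H) (r : G) (hr : r ∈ sri (L '' dom f - dom g)) :
    (Argmin (dualObjective f g L z r)).Nonempty := by
  obtain ⟨v, μ, hμ, hv⟩ :=
    exists_subgradient_value hf_bot hf_conv hf_lsc hg_bot hg_conv hg_lsc L z r hr
  -- The supremum defining the envelope of `f*` is attained at a proximal point `p`, and the
  -- subgradient inequality at the perturbation `L p - r - y` bounds `g*(-v)` by testing each `y`.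
  have hupper : dualObjective f g L z r (-v) ≤ ((1 / 2 * ‖z‖ ^ 2 - μ : ℝ) : EReal) := by
    rw [dualObjective, moreauEnvelope_conj_eq hf_bot hf_conv (hprox _)]
    obtain ⟨a, ha, -⟩ := exists_coe_eq_prox hf_bot hf_conv
      (hprox (z - ContinuousLinearMap.adjoint L (-v)))
    generalize prox f (z - ContinuousLinearMap.adjoint L (-v)) = p at *
    rw [ha, EReal.toReal_coe]
    have hg : conj g (-v) ≤ ((a + 1 / 2 * ‖z - p‖ ^ 2 - μ - inner ℝ v (L p - r) : ℝ) : EReal) := by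
      refine conj_le_coe_iff.2 fun y => ?_
      have h := (hv (L p - r - y)).trans (iInf_le _ p)
      simp only [proxObjective, ha, sub_sub_cancel] at h
      induction hgy : g y with
      | bot => exact absurd hgy (hg_bot y)
      | top => exact le_top
      | coe b =>
        rw [hgy] at h
        norm_cast at h ⊢
        rw [inner_sub_right v (L p - r) y] at h
        rw [inner_neg_right, real_inner_comm]
        linarith
    refine (add_le_add (add_le_add le_rfl hg) le_rfl).trans (le_of_eq ?_)
    rw [← EReal.coe_add, ← EReal.coe_add]
    congr 1
    rw [norm_sub_sq_real, inner_sub_right, inner_sub_right, map_neg, inner_neg_right,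
      inner_neg_left, ContinuousLinearMap.adjoint_inner_right, real_inner_comm p z,
      real_inner_comm v (L p)]
    ring
  have hlower : ∀ w, ((1 / 2 * ‖z‖ ^ 2 - μ : ℝ) : EReal) ≤ dualObjective f g L z r w := by
    intro w
    refine EReal.ge_of_forall_gt_iff_ge.1 fun c hc => ?_
    rw [EReal.coe_lt_coe_iff] at hc
    have hlt : moreauEnvelope (fun x => f x + g (L x - r)) z <
        ((1 / 2 * ‖z‖ ^ 2 - c : ℝ) : EReal) := by
      rw [hμ, EReal.coe_lt_coe_iff]; linarith
    obtain ⟨x, hx⟩ := iInf_lt_iff.1 hlt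
    obtain ⟨h1, h2⟩ := lt_top_of_proxObjective_lt_top (u := fun x => L x - r) hf_bot hg_bot
      (hx.trans (EReal.coe_lt_top _))
    have ha := EReal.coe_toReal h1.ne (hf_bot x)
    have hb := EReal.coe_toReal h2.ne (hg_bot _)
    refine le_trans ?_ (coe_le_dualObjective ha.ge hb.ge w)
    rw [proxObjective, ← ha, ← hb] at hx
    norm_cast at hx ⊢
    linarith
  exact ⟨-v, hupper.trans_lt (EReal.coe_lt_top _), fun w => hupper.trans (hlower w)⟩

/-- Fermat's rule for the dual problem: the envelope term of the objective is differentiable, with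
gradient `-L (prox f (z - L* v))` at `v`. -/
theorem mem_argmin_dualObjective_iff (hf_bot : ∀ x, f x ≠ ⊥) (hf_conv : IsConvex f)
    (hprox : ∀ w, ∃! p, p ∈ Argmin (proxObjective f w)) (hg_dom : (dom g).Nonempty)
    {L : H →L[ℝ] G} {z : H} {r : G} (hdual : (dom (dualObjective f g L z r)).Nonempty) (v : G) :
    v ∈ Argmin (dualObjective f g L z r) ↔
      L (prox f (z - ContinuousLinearMap.adjoint L v)) - r ∈ subdiff (conj g) v := by
  have hreal : ∀ w, ∃ A : ℝ, moreauEnvelope (conj f) w = A := fun w =>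
    ⟨_, moreauEnvelope_conj_eq hf_bot hf_conv (hprox w)⟩
  have hgbot := conj_ne_bot hg_dom
  obtain ⟨A, hA⟩ := hreal (z - ContinuousLinearMap.adjoint L v)
  have hdiff : ∀ y, (z - ContinuousLinearMap.adjoint L y) - (z - ContinuousLinearMap.adjoint L v) =
      -(ContinuousLinearMap.adjoint L (y - v)) := by
    intro y; rw [map_sub]; abel
  have hlow := fun y => moreauEnvelope_conj_add_inner_le hf_bot hf_conv hprox
    (z - ContinuousLinearMap.adjoint L v) (z - ContinuousLinearMap.adjoint L y)
  have hupp := fun y => moreauEnvelope_conj_le_add_inner hf_bot hf_conv hprox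
    (z - ContinuousLinearMap.adjoint L v) (z - ContinuousLinearMap.adjoint L y)
  simp only [hdiff, hA, inner_neg_left, ContinuousLinearMap.adjoint_inner_left, norm_neg]
    at hlow hupp
  generalize prox f (z - ContinuousLinearMap.adjoint L v) = p at *
  constructor
  · rintro ⟨hdom, hmin⟩ y
    induction hgv : conj g v with
    | bot => exact absurd hgv (hgbot v)
    | top =>
      rw [dom, mem_ofPred_eq, dualObjective, hgv, hA, EReal.coe_add_top, EReal.top_add_coe] at hdom
      exact absurd hdom (lt_irrefl _)
    | coe c =>
    rw [← EReal.coe_add]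
    refine EReal.le_of_forall_lt_iff_le.1 fun β hβ => ?_
    rw [EReal.coe_le_coe_iff]
    suffices 0 ≤ β - c - inner ℝ (y - v) (L p - r) by linarith
    -- Compare `v` with `v + t (y - v)`; the envelope contributes an error of order `t²`.
    refine nonneg_of_forall_nonneg_mul_add_sq_mul
      (b := 1 / 2 * ‖ContinuousLinearMap.adjoint L (y - v)‖ ^ 2) fun t ht ht1 => ?_
    have hconv := conj_convexCombination_le_coe (sub_nonneg.2 ht1.le) ht.le (by ring) hgv.le hβ.le
    have hstep : (1 - t) • v + t • y - v = t • (y - v) := by module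
    have h := (hmin ((1 - t) • v + t • y)).trans
      (add_le_add (add_le_add (hupp _) hconv) le_rfl)
    rw [dualObjective, hA, hgv, hstep] at h
    norm_cast at h
    simp only [map_smul, norm_smul, mul_pow, Real.norm_eq_abs, sq_abs, inner_add_left,
      real_inner_smul_left] at h
    rw [inner_sub_right, inner_sub_left y v r]
    linarith
  · intro h
    have hmin : ∀ y, dualObjective f g L z r v ≤ dualObjective f g L z r y := by
      intro y
      obtain ⟨B, hB⟩ := hreal (z - ContinuousLinearMap.adjoint L y)
      have h1 := hlow y
      have h2 := h y
      rw [hB] at h1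
      rw [dualObjective, dualObjective, hA, hB]
      induction hgy : conj g y with
      | bot => exact absurd hgy (hgbot y)
      | top => rw [EReal.coe_add_top, EReal.top_add_coe]; exact le_top
      | coe d =>
      induction hgv : conj g v with
      | bot => exact absurd hgv (hgbot v)
      | top =>
        rw [hgv, hgy, EReal.coe_add_top, top_le_iff] at h2
        exact absurd h2 (EReal.coe_ne_top d)
      | coe c =>
        rw [hgv, hgy] at h2
        norm_cast at h1 h2 ⊢
        rw [inner_sub_right, inner_sub_left y v r] at h2
        linarith
    obtain ⟨v₀, hv₀⟩ := hdual
    exact ⟨(hmin v₀).trans_lt hv₀, hmin⟩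

end Duality

end FenchelDuality

theorem proposition3p2
    {H G : Type*} [NormedAddCommGroup H] [InnerProductSpace ℝ H] [CompleteSpace H]
    [NormedAddCommGroup G] [InnerProductSpace ℝ G] [CompleteSpace G]
    (f : H → EReal) (hf_bot : ∀ x, f x ≠ ⊥) (hf_conv : FenchelDuality.IsConvex f)
    (hf_lsc : LowerSemicontinuous f)
    (g : G → EReal) (hg_bot : ∀ y, g y ≠ ⊥) (hg_conv : FenchelDuality.IsConvex g)
    (hg_lsc : LowerSemicontinuous g)
    (L : H →L[ℝ] G) (hL : L ≠ 0) (z : H) (r : G)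
    (hr : r ∈ FenchelDuality.sri (L '' FenchelDuality.dom f - FenchelDuality.dom g)) :
    -- the primal problem is to minimize `φ + ψ ∘ L`, where `φ = f + ½‖· - z‖²`, `ψ = g(· - r)`
    (∀ x : H, FenchelDuality.primalObjective f g L z r x =
      (fun x' : H => f x' + ((1 / 2 * ‖x' - z‖ ^ 2 : ℝ) : EReal)) x
        + (fun y : G => g (y - r)) (L x)) ∧
    -- the objective of its dual problem is `dualObjective`, up to the constant `½‖z‖²`
    (∀ v : G, FenchelDuality.fenchelDualObjective
        (fun x' : H => f x' + ((1 / 2 * ‖x' - z‖ ^ 2 : ℝ) : EReal))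
        (fun y : G => g (y - r)) L v =
      FenchelDuality.dualObjective f g L z r v - ((1 / 2 * ‖z‖ ^ 2 : ℝ) : EReal)) ∧
    -- and the two dual objectives have the same minimizers
    FenchelDuality.Argmin (FenchelDuality.fenchelDualObjective
        (fun x' : H => f x' + ((1 / 2 * ‖x' - z‖ ^ 2 : ℝ) : EReal))
        (fun y : G => g (y - r)) L) =
      FenchelDuality.Argmin (FenchelDuality.dualObjective f g L z r) ∧
    -- the dual problem has a solution
    (FenchelDuality.Argmin (FenchelDuality.dualObjective f g L z r)).Nonempty ∧
    -- `prox f` is well defined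
    (∀ x : H, ∃! p : H, p ∈ FenchelDuality.Argmin (FenchelDuality.proxObjective f x)) ∧
    -- the solutions of the dual problem are characterized by the inclusion
    (∀ v : G, v ∈ FenchelDuality.Argmin (FenchelDuality.dualObjective f g L z r) ↔
      L (FenchelDuality.prox f (z - ContinuousLinearMap.adjoint L v)) - r
        ∈ FenchelDuality.subdiff (FenchelDuality.conj g) v) := by
  obtain ⟨_, ⟨x₀, hx₀, rfl⟩, y₀, hy₀, -⟩ := hr.1
  have hprox := FenchelDuality.existsUnique_argmin_proxObjective hf_bot hf_conv hf_lsc ⟨x₀, hx₀⟩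
  have hdual := FenchelDuality.fenchelDualObjective_eq (g := g) hf_bot hf_conv hprox L z r
  have hsol := FenchelDuality.argmin_dualObjective_nonempty hf_bot hf_conv hf_lsc hg_bot hg_conv
    hg_lsc hprox L z r hr
  refine ⟨fun x => add_right_comm _ _ _, hdual, ?_, hsol, hprox, fun v => ?_⟩
  · rw [funext hdual, FenchelDuality.argmin_sub_coe]
  · exact FenchelDuality.mem_argmin_dualObjective_iff hf_bot hf_conv hprox ⟨y₀, hy₀⟩
      (hsol.mono fun _ h => h.1) v
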